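/- **Notation.** For $g\in L^1(\mathbb R^n)$ real-valued let $\hat g(\omega)=(2\pi)^{-n}\int_{\mathbb R^n} g(x)e^{-i\langle\omega,x\rangle}\,dx$. For $B\subseteq\mathbb R^n$ let $\|\omega\|_B=\sup_{x\in B}|\langle\omega,x\rangle|\in[0,\infty]$, and let $\mathcal F_B$ be the set of integrable $g:\mathbb R^n\to\mathbb R$ such that for every $x\in B$ one has $g(x)=g(0)+\int_{\mathbb R^n}(e^{i\langle\omega,x\rangle}-1)\hat g(\omega)\,d\omega$, the integral converging absolutely. For $C\ge 0$ write $f\in\Gamma_B(C)$ if there is $g\in\mathcal F_B$ with $g|_B=f|_B$ and $\int_{\mathbb R^n}\|\omega\|_B|\hat g(\omega)|\,d\omega\le C$; a vector-valued $f$ is in $\Gamma_B(C)$ if each of its components is. $B_n$ is the closed Euclidean unit ball of $\mathbb R^n$, $\|\cdot\|$ is the Euclidean norm, and $f_{l:1}=f_l\circ\cdots\circ f_1$. A sigmoidal function is a bounded measurable $\sigma:\mathbb R\to\mathbb R$ with $\lim_{t\to-\infty}\sigma(t)=0$ and $\lim_{t\to\infty}\sigma(t)=1$. A neural network with activation $\sigma$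 and $l$ hidden layers of sizes $n_1,\dots,n_l$ computes $x^{(0)}=x$, $x^{(i)}=\sigma(A^{(i)}x^{(i-1)}+b^{(i)})\in\mathbb R^{n_i}$ for $1\le i\le l$ ($\sigma$ applied componentwise), and outputs $A^{(l+1)}x^{(l)}+b^{(l+1)}$, with real matrices $A^{(i)}$ and vectors $b^{(i)}$. **Theorem 3.2.** Let $\varepsilon,s>0$, $l\ge 1$, and let $\sigma$ be a sigmoidal function. For $0\le i\le l$ let $m_i\in\mathbb N$, $K_i\subseteq\mathbb R^{m_i}$ and $C_i\ge 0$; for $1\le i\le l$ let $f_i:\mathbb R^{m_{i-1}}\to\mathbb R^{m_i}$; and let $\mu_0$ be a Borel probability measure on $\mathbb R^{m_0}$. Suppose that 1. $\operatorname{Supp}(\mu_0)\subseteq K_0$; 2. each $f_i$, $1\le i\le l$, is Lipschitz with constant at most $1$ for the Euclidean norms; 3. $f_1\in\Gamma_{K_0}(C_0)$, and $f_i\in\Gamma_{K_{i-1}+sB_{m_{i-1}}}(C_i)$ for $1\le i\le l$; 4. $f_i(K_{i-1})\subseteq K_i$ for $1\le i\le l$. Then there exist a neural network $g:\mathbb R^{m_0}\to\mathbb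 R^{m_l}$ with activation $\sigma$ and $l$ hidden layers, the $i$-th of which has $m_i\left\lceil 4C_i^2m_i/\varepsilon^2\right\rceil$ nodes, and a Borel set $S\subseteq\mathbb R^{m_0}$ with $$\mu_0(S)\ \ge\ 1-\Bigl(\sum_{i=1}^{l-1}i^2\Bigr)\frac{\varepsilon^2}{s^2},$$ such that $\mathbf 1_S\|f_{l:1}-g\|^2$ is $\mu_0$-integrable and $$\Bigl(\int \mathbf 1_S\,\|f_{l:1}-g\|^2\,d\mu_0\Bigr)^{1/2}\ \le\ l\,\varepsilon .$$ -/

import Mathlib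

open MeasureTheory Filter Topology
open scoped NNReal ENNReal Pointwise

noncomputable section

namespace MultiBarron

/-- The Euclidean space `ℝⁿ` with its `2`-norm. -/
abbrev E (n : ℕ) : Type := EuclideanSpace ℝ (Fin n)

/-- The Fourier transform `ĝ(ω) = (2π)⁻ⁿ ∫ g(x) exp(-i⟨ω, x⟩) dx` of a real function on `ℝⁿ`.
It is only used below for integrable `g`. -/
def fourierHat {n : ℕ} (g : E n → ℝ) (ω : E n) : ℂ :=
  (((2 * Real.pi) ^ n)⁻¹ : ℝ) *
    ∫ x : E n, (g x : ℂ) * Complex.exp (-(Complex.I * (inner ℝ ω x : ℝ)))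

/-- `‖ω‖_B = sup_{x ∈ B} |⟨ω, x⟩|`, with values in `[0, ∞]`. -/
def dualNorm {n : ℕ} (B : Set (E n)) (ω : E n) : ℝ≥0∞ :=
  ⨆ x ∈ B, ENNReal.ofReal |inner ℝ ω x|

/-- `‖g‖*_B = ∫ ‖ω‖_B |ĝ(ω)| dω`, with values in `[0, ∞]`. -/
def barronNorm {n : ℕ} (B : Set (E n)) (g : E n → ℝ) : ℝ≥0∞ :=
  ∫⁻ ω : E n, dualNorm B ω * ENNReal.ofReal ‖fourierHat g ω‖

/-- The class `𝓕_B` of the integrable functions `g : ℝⁿ → ℝ` for which the Fourier inversion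
formula holds on `B` after subtracting `g(0)`:
`g(x) = g(0) + ∫ (exp(i⟨ω, x⟩) - 1) ĝ(ω) dω` for all `x ∈ B`, the integral being convergent. -/
def inversionClass {n : ℕ} (B : Set (E n)) : Set (E n → ℝ) :=
  {g | Integrable g ∧ ∀ x ∈ B,
    Integrable (fun ω : E n =>
      (Complex.exp (Complex.I * (inner ℝ ω x : ℝ)) - 1) * fourierHat g ω) ∧
    (g x : ℂ) = (g 0 : ℂ) +
      ∫ ω : E n, (Complex.exp (Complex.I * (inner ℝ ω x : ℝ)) - 1) * fourierHat g ω}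

/-- `f ∈ Γ_B(C)`, i.e. the restriction to `B` of the real function `f` is `C`-Barron on `B`:
it has an extension `g ∈ 𝓕_B` to `ℝⁿ` with `‖g‖*_B ≤ C`. Only the values of `f` on `B` matter. -/
def IsBarron {n : ℕ} (B : Set (E n)) (C : ℝ≥0) (f : E n → ℝ) : Prop :=
  ∃ g ∈ inversionClass B, Set.EqOn g f B ∧ barronNorm B g ≤ C

/-- A vector-valued function is `C`-Barron on `B` if each of its components is. -/
def IsBarronVec {n p : ℕ} (B : Set (E n)) (C : ℝ≥0) (f : E n → E p) : Prop :=
  ∀ j : Fin p, IsBarron B C (fun x => f x j)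

/-- A sigmoidal function: bounded, measurable, with limits `0` at `-∞` and `1` at `∞`. -/
structure IsSigmoidal (σ : ℝ → ℝ) : Prop where
  bounded : ∃ M : ℝ, ∀ t, |σ t| ≤ M
  measurable : Measurable σ
  tendsto_atBot : Tendsto σ atBot (𝓝 0)
  tendsto_atTop : Tendsto σ atTop (𝓝 1)

/-- The parameters of a feedforward neural network with input space `ℝᵖ`, output space `ℝ^q` and
hidden layers whose sizes, from the input to the output, are the entries of the list; so the
length of the list is the number of hidden layers. Each layer has a weight matrix and a bias. -/
inductive NeuralNet : ℕ → List ℕ → ℕ → Type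
  /-- The affine output layer. -/
  | output {p q : ℕ} (A : Matrix (Fin q) (Fin p) ℝ) (b : Fin q → ℝ) : NeuralNet p [] q
  /-- A hidden layer with `h` nodes, followed by the rest of the network. -/
  | hidden {p h q : ℕ} {hs : List ℕ} (A : Matrix (Fin h) (Fin p) ℝ) (b : Fin h → ℝ)
      (N : NeuralNet h hs q) : NeuralNet p (h :: hs) q

/-- The function computed by a neural network with activation function `σ`: a hidden layer
maps `x` to `σ(A x + b)`, with `σ` applied componentwise, and the output layer maps `x` to
`A x + b`. -/
def NeuralNet.eval (σ : ℝ → ℝ) : {p : ℕ} → {hs : List ℕ} → {q : ℕ} →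
    NeuralNet p hs q → E p → E q
  | _, _, _, .output A b, x => WithLp.toLp 2 (fun j => (A.mulVec x.ofLp) j + b j)
  | _, _, _, .hidden A b N, x =>
      N.eval σ (WithLp.toLp 2 (fun j => σ ((A.mulVec x.ofLp) j + b j)))

/-- The composition `f_{l:1} = f_l ∘ ⋯ ∘ f_1`, where `f_{i+1} : ℝ^{m_i} → ℝ^{m_{i+1}}` is
written `f i`. -/
def chain {m : ℕ → ℕ} (f : ∀ i, E (m i) → E (m (i + 1))) : (l : ℕ) → E (m 0) → E (m l)
  | 0, x => x
  | l + 1, x => f l (chain f l x)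

end MultiBarron

end

/-!
A Barron function `f` on `B` is a constant plus `∫ re ((exp(i⟨ω, x⟩) - 1) ĝ(ω)) dω`. Each integrand
is an oscillation in `u = ⟨ω, x⟩ ∈ [-‖ω‖_B, ‖ω‖_B]` with derivative at most `|ĝ(ω)|`, so it is a
mixture of the indicators of the half-lines `u ≥ v`. Up to a constant, `f` is therefore a mixture
of the functions `± (1_{⟨ω, x⟩ ≥ v} - 1 / 2)` of total mass at most `2 C`
(`IsBarron.exists_mixture`). Maurey's argument (`exists_average_approx`) samples `k` of these
independently; the mean square error is at most `C² / k` in expectation, hence for some sample.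
As this is strictly below `4 C² / k` when `C > 0`, the indicators can be replaced by the sigmoids
`σ(N² (u - v) + N)` with `N` large (`IsBarron.exists_sigmoid_approx`); when `C = 0` the function is
constant on `B` and no node is used. Treating the components separately gives one hidden layer
(`IsBarronVec.exists_layer`). This is done for the law of an arbitrary random vector `Y` with values
in `B`, which is applied to the output of the layers already constructed.

For a chain (`exists_net_chain`), a new layer adds at most `ε` to the `L²` error, and the old error
is not amplified since the functions are `1`-Lipschitz. The new layer only has to be accurate where
the network has stayed in the `s`-neighbourhood of `K i`. If the `L²` error after `i` layers is at
most `i ε`, Chebyshev's inequality shows that this fails on a set of measure at most `i² ε² / s²`;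
these sets are discarded.
-/

noncomputable section

namespace MultiBarron

/-! ### Sampling from a mixture of bounded functions -/

/-- The average of `k` independent samples of a random variable with values in `[-b, b]` has mean
square distance at most `b² / k` to the expectation. -/
lemma integral_sq_sub_average_le {Θ : Type*} [MeasurableSpace Θ] (P : Measure Θ)
    [IsProbabilityMeasure P] {b : ℝ} {h : Θ → ℝ} (hm : Measurable h) (hb : ∀ θ, |h θ| ≤ b)
    {k : ℕ} (hk : k ≠ 0) :
    ∫ θ : Fin k → Θ, (∫ t, h t ∂P - (k : ℝ)⁻¹ * ∑ j, h (θ j)) ^ 2 ∂(Measure.pi fun _ => P)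
      ≤ b ^ 2 / k := by
  have hk' : (k : ℝ) ≠ 0 := by exact_mod_cast hk
  have hLp : MemLp h 2 P :=
    MemLp.of_bound hm.aestronglyMeasurable b (Eventually.of_forall hb)
  set Q : Measure (Fin k → Θ) := Measure.pi fun _ => P
  let Z : (Fin k → Θ) → ℝ := ∑ j : Fin k, fun θ => h (θ j)
  have hZ : ∀ θ, Z θ = ∑ j, h (θ j) := fun θ => by simp [Z]
  have hZm : Measurable Z := by
    have : Z = fun θ => ∑ j, h (θ j) := funext hZ
    rw [this]; fun_prop
  have hmean : ∫ θ, Z θ ∂Q = k * ∫ t, h t ∂P := by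
    simp_rw [hZ]
    rw [integral_finsetSum]
    · simp [Q, integral_comp_eval (μ := fun _ : Fin k => P) hm.aestronglyMeasurable]
    · intro j _
      exact Integrable.of_bound (hm.comp (measurable_pi_apply j)).aestronglyMeasurable b
        (Eventually.of_forall fun θ => hb _)
  have hvar : ProbabilityTheory.variance Z Q ≤ k * b ^ 2 := by
    rw [ProbabilityTheory.variance_sum_pi (fun _ => hLp)]
    calc ∑ _j : Fin k, ProbabilityTheory.variance h P ≤ ∑ _j : Fin k, b ^ 2 := by
          refine Finset.sum_le_sum fun j _ => ?_
          have := ProbabilityTheory.variance_le_sq_of_bounded (μ := P) (a := -b) (b := b) (X := h)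
            (Eventually.of_forall fun θ => abs_le.mp (hb θ)) hm.aemeasurable
          simpa using this
      _ = k * b ^ 2 := by simp
  rw [ProbabilityTheory.variance_eq_integral hZm.aemeasurable, hmean] at hvar
  have heq : ∀ θ : Fin k → Θ, (∫ t, h t ∂P - (k : ℝ)⁻¹ * ∑ j, h (θ j)) ^ 2
      = ((k : ℝ) ^ 2)⁻¹ * (Z θ - k * ∫ t, h t ∂P) ^ 2 := by
    intro θ
    rw [hZ]; field_simp; ring
  simp_rw [heq]
  rw [integral_const_mul]
  calc ((k : ℝ) ^ 2)⁻¹ * ∫ θ, (Z θ - k * ∫ t, h t ∂P) ^ 2 ∂Q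
      ≤ ((k : ℝ) ^ 2)⁻¹ * (k * b ^ 2) := by gcongr
    _ = b ^ 2 / k := by field_simp

/-- Maurey's sampling argument: an average of functions with values in `[-b, b]` over a probability
space is approximated in mean square, up to `b² / k`, by the mean of some `k` of them. -/
lemma exists_average_approx {X Θ : Type*} [MeasurableSpace X] [MeasurableSpace Θ]
    (μ : Measure X) [IsFiniteMeasure μ] (hμ : μ.real Set.univ ≤ 1)
    (P : Measure Θ) [IsProbabilityMeasure P] {b : ℝ} {h : Θ → X → ℝ}
    (hm : Measurable fun p : Θ × X => h p.1 p.2) (hb : ∀ θ x, |h θ x| ≤ b)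
    {k : ℕ} (hk : k ≠ 0) :
    ∃ θ : Fin k → Θ,
      ∫ x, (∫ t, h t x ∂P - (k : ℝ)⁻¹ * ∑ j, h (θ j) x) ^ 2 ∂μ ≤ b ^ 2 / k := by
  have hk' : (k : ℝ) ≠ 0 := by exact_mod_cast hk
  set Q : Measure (Fin k → Θ) := Measure.pi fun _ => P
  have hmean_m : Measurable fun x => ∫ t, h t x ∂P := by
    have : StronglyMeasurable fun p : X × Θ => h p.2 p.1 :=
      (hm.comp measurable_swap).stronglyMeasurable
    exact (this.integral_prod_right (ν := P)).measurable
  have hmean_b : ∀ x, |∫ t, h t x ∂P| ≤ b := by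
    intro x
    have := norm_integral_le_of_norm_le_const (μ := P) (f := fun t => h t x) (C := b)
      (Eventually.of_forall fun t => hb t x)
    simpa using this
  let F : (Fin k → Θ) → X → ℝ := fun θ x =>
    (∫ t, h t x ∂P - (k : ℝ)⁻¹ * ∑ j, h (θ j) x) ^ 2
  have hFm : Measurable fun p : (Fin k → Θ) × X => F p.1 p.2 := by
    have h1 : ∀ j : Fin k, Measurable fun p : (Fin k → Θ) × X => h (p.1 j) p.2 := fun j =>
      hm.comp (f := fun p : (Fin k → Θ) × X => (p.1 j, p.2)) (by fun_prop)
    have h2 : Measurable fun p : (Fin k → Θ) × X => ∫ t, h t p.2 ∂P :=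
      hmean_m.comp measurable_snd
    have h3 : Measurable fun p : (Fin k → Θ) × X => ∑ j, h (p.1 j) p.2 :=
      Finset.measurable_sum _ fun j _ => h1 j
    exact (h2.sub (h3.const_mul _)).pow_const 2
  have hFb : ∀ θ x, ‖F θ x‖ ≤ (b + b) ^ 2 := by
    intro θ x
    have h1 : |(k : ℝ)⁻¹ * ∑ j, h (θ j) x| ≤ b := by
      rw [abs_mul, abs_of_nonneg (by positivity : (0 : ℝ) ≤ (k : ℝ)⁻¹)]
      calc (k : ℝ)⁻¹ * |∑ j, h (θ j) x| ≤ (k : ℝ)⁻¹ * ∑ _j : Fin k, b := by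
            gcongr
            exact (Finset.abs_sum_le_sum_abs _ _).trans
              (Finset.sum_le_sum fun j _ => hb _ _)
        _ = b := by simp; field_simp
    have h2 : |∫ t, h t x ∂P - (k : ℝ)⁻¹ * ∑ j, h (θ j) x| ≤ b + b :=
      (abs_sub _ _).trans (add_le_add (hmean_b x) h1)
    simp only [F, norm_pow, Real.norm_eq_abs]
    gcongr
  have hFi : Integrable (fun p : (Fin k → Θ) × X => F p.1 p.2) (Q.prod μ) :=
    Integrable.of_bound hFm.aestronglyMeasurable _ (Eventually.of_forall fun p => hFb _ _)
  obtain ⟨θ, hθ⟩ := exists_le_integral (μ := Q) hFi.integral_prod_left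
  refine ⟨θ, hθ.trans ?_⟩
  rw [integral_integral_swap hFi]
  calc ∫ x, ∫ θ, F θ x ∂Q ∂μ ≤ ∫ _x, b ^ 2 / k ∂μ := by
        refine integral_mono hFi.integral_prod_right (integrable_const _) fun x => ?_
        exact integral_sq_sub_average_le P (hm.comp (measurable_prodMk_right)) (fun t => hb t x) hk
    _ = μ.real Set.univ * (b ^ 2 / k) := by simp
    _ ≤ 1 * (b ^ 2 / k) := by gcongr
    _ = b ^ 2 / k := one_mul _

/-! ### Barron functions as mixtures of half-space indicators -/

lemma continuous_fourierHat {n : ℕ} {g : E n → ℝ} (hg : Integrable g) :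
    Continuous (fourierHat g) := by
  unfold fourierHat
  refine continuous_const.mul ?_
  refine continuous_of_dominated (bound := fun x => |g x|) (fun ω => ?_) (fun ω => ?_) hg.abs ?_
  · refine hg.ofReal.aestronglyMeasurable.mul (Continuous.aestronglyMeasurable ?_)
    fun_prop
  · refine Eventually.of_forall fun x => ?_
    have : ‖Complex.exp (-(Complex.I * (inner ℝ ω x : ℝ)))‖ = 1 := by
      rw [Complex.norm_exp]; simp
    simp [this]
  · refine Eventually.of_forall fun x => ?_
    fun_prop

lemma measurable_dualNorm {n : ℕ} (B : Set (E n)) : Measurable (dualNorm B) := by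
  refine LowerSemicontinuous.measurable ?_
  unfold dualNorm
  refine lowerSemicontinuous_biSup fun x _ => Continuous.lowerSemicontinuous ?_
  exact ENNReal.continuous_ofReal.comp (by fun_prop)

lemma abs_inner_le_toReal_dualNorm {n : ℕ} {B : Set (E n)} {ω x : E n} (hx : x ∈ B)
    (h : dualNorm B ω ≠ ∞) : |inner ℝ ω x| ≤ (dualNorm B ω).toReal := by
  have : ENNReal.ofReal |inner ℝ ω x| ≤ dualNorm B ω :=
    le_iSup₂ (f := fun x (_ : x ∈ B) => ENNReal.ofReal |inner ℝ ω x|) x hx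
  exact (ENNReal.ofReal_le_iff_le_toReal h).mp this

/-- The indicator of the half-line `[v, ∞)`, as a function of `v` and the point `u`. -/
def unitStep (v u : ℝ) : ℝ := if v ≤ u then 1 else 0

lemma measurable_unitStep : Measurable fun p : ℝ × ℝ => unitStep p.1 p.2 :=
  Measurable.ite (measurableSet_le measurable_fst measurable_snd) measurable_const
    measurable_const

lemma abs_unitStep_sub_half (v u : ℝ) : |unitStep v u - 1 / 2| = 1 / 2 := by
  unfold unitStep; split_ifs <;> norm_num [abs_of_pos, abs_of_neg]

lemma abs_unitStep_le (v u : ℝ) : |unitStep v u| ≤ 1 := by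
  unfold unitStep; split_ifs <;> simp

/-- The integral of `ψ` from `0` to `u` is a mixture of indicators of half-lines. -/
lemma integral_mul_unitStep_sub {ψ : ℝ → ℝ} (hψ : Continuous ψ) {u N : ℝ} (hu : |u| ≤ N) :
    ∫ v in Set.Icc (-N) N, ψ v * (unitStep v u - unitStep v 0) = ∫ v in (0 : ℝ)..u, ψ v := by
  have hN : 0 ≤ N := (abs_nonneg u).trans hu
  have key : ∀ w : ℝ, |w| ≤ N →
      ∫ v in (-N)..N, ψ v * unitStep v w = ∫ v in (-N)..w, ψ v := by
    intro w hw
    rw [← intervalIntegral.integral_indicator (f := ψ) (abs_le.mp hw : w ∈ Set.Icc (-N) N)]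
    refine intervalIntegral.integral_congr fun v _ => ?_
    simp [unitStep, Set.indicator_apply]
  have hint : ∀ w : ℝ, IntervalIntegrable (fun v => ψ v * unitStep v w) volume (-N) N := by
    intro w
    rw [intervalIntegrable_iff]
    refine ((hψ.intervalIntegrable (-N) N).def').mul_bdd (c := 1) ?_ ?_
    · exact (measurable_unitStep.comp (measurable_id.prodMk measurable_const)).aestronglyMeasurable
    · exact Eventually.of_forall fun v => abs_unitStep_le _ _
  rw [integral_Icc_eq_integral_Ioc, ← intervalIntegral.integral_of_le (by linarith)]
  simp_rw [mul_sub]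
  rw [intervalIntegral.integral_sub (hint u) (hint 0), key u hu, key 0 (by simpa using hN),
    intervalIntegral.integral_interval_sub_left (hψ.intervalIntegrable _ _)
      (hψ.intervalIntegrable _ _)]

/-- The real part of `i e^{iv} z / |z|`: the density, with respect to `|z| dv`, of the oscillation
`v ↦ re (e^{iv} z)`. The division by zero at `z = 0` gives the value `0`. -/
def phaseDeriv (z : ℂ) (v : ℝ) : ℝ := (Complex.I * Complex.exp (Complex.I * v) * z).re / ‖z‖

lemma abs_phaseDeriv_le (z : ℂ) (v : ℝ) : |phaseDeriv z v| ≤ 1 := by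
  unfold phaseDeriv
  rw [abs_div, abs_norm]
  refine div_le_one_of_le₀ ((Complex.abs_re_le_norm _).trans_eq ?_) (norm_nonneg _)
  simp [Complex.norm_exp]

lemma norm_mul_phaseDeriv (z : ℂ) (v : ℝ) :
    ‖z‖ * phaseDeriv z v = (Complex.I * Complex.exp (Complex.I * v) * z).re := by
  unfold phaseDeriv
  rcases eq_or_ne z 0 with rfl | hz
  · simp
  · rw [mul_div_cancel₀ _ (norm_ne_zero_iff.mpr hz)]

lemma continuous_phaseDeriv (z : ℂ) : Continuous (phaseDeriv z) := by
  unfold phaseDeriv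
  fun_prop

lemma norm_mul_integral_phaseDeriv (z : ℂ) (u : ℝ) :
    ‖z‖ * ∫ v in (0 : ℝ)..u, phaseDeriv z v = ((Complex.exp (Complex.I * u) - 1) * z).re := by
  rw [← intervalIntegral.integral_const_mul]
  simp_rw [norm_mul_phaseDeriv]
  have hd : ∀ v ∈ Set.uIcc 0 u, HasDerivAt
      (fun v : ℝ => ((Complex.exp (Complex.I * v) - 1) * z).re)
      (Complex.I * Complex.exp (Complex.I * v) * z).re v := by
    intro v _
    have h1 : HasDerivAt (fun w : ℂ => (Complex.exp (Complex.I * w) - 1) * z)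
        (Complex.exp (Complex.I * v) * (Complex.I * 1) * z) (v : ℂ) :=
      ((((hasDerivAt_id (v : ℂ)).const_mul Complex.I).cexp).sub_const 1).mul_const z
    convert! h1.real_of_complex using 2
    ring
  rw [intervalIntegral.integral_eq_sub_of_hasDerivAt hd
    (Continuous.intervalIntegrable (by fun_prop) _ _)]
  simp

/-- A `C`-Barron function on `B` is, up to a constant, a mixture of the functions
`± (1_{⟨ω, x⟩ ≥ v} - 1 / 2)`, of total mass at most `2 C`. Centring the indicators halves their
size, which gains a factor `4` in the sampling bound. -/
theorem IsBarron.exists_mixture {n : ℕ} {B : Set (E n)} {C : ℝ≥0} {f : E n → ℝ}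
    (hf : IsBarron B C f) :
    ∃ (ρ : Measure (E n × ℝ)) (r : E n × ℝ → ℝ) (c : ℝ), ρ Set.univ ≤ 2 * C ∧ Measurable r ∧
      (∀ p, |r p| ≤ 1) ∧
      ∀ x ∈ B, f x = c + ∫ p, r p * (unitStep p.2 (inner ℝ p.1 x) - 1 / 2) ∂ρ := by
  obtain ⟨g, ⟨hgi, hinv⟩, hgf, hnorm⟩ := hf
  have hGc := continuous_fourierHat hgi
  set G := fourierHat g
  let lam : Measure (E n) := volume.withDensity fun ω => (‖G ω‖₊ : ℝ≥0∞)
  let N : E n → ℝ := fun ω => (dualNorm B ω).toReal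
  have hNm : Measurable N := (measurable_dualNorm B).ennreal_toReal
  have hGm : Measurable fun ω => ‖G ω‖₊ := hGc.nnnorm.measurable
  have hlint : ∫⁻ ω, dualNorm B ω ∂lam ≤ C := by
    rw [lintegral_withDensity_eq_lintegral_mul _ (by fun_prop) (measurable_dualNorm B)]
    refine le_trans (lintegral_mono fun ω => ?_) hnorm
    rw [Pi.mul_apply, mul_comm, ofReal_norm]
    exact le_rfl
  -- Where `‖ω‖_B = ∞` the transform vanishes almost everywhere, so that the junk value `0` of
  -- `N` does no harm.
  have hfin : ∀ᵐ ω ∂lam, dualNorm B ω ≠ ∞ := by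
    filter_upwards [ae_lt_top (measurable_dualNorm B) (hlint.trans_lt ENNReal.coe_lt_top).ne]
      with ω hω using hω.ne
  let D : Set (E n × ℝ) := {p | p.2 ∈ Set.Icc (-N p.1) (N p.1)}
  have hD : MeasurableSet D := by
    have h1 : MeasurableSet {p : E n × ℝ | -N p.1 ≤ p.2} :=
      measurableSet_le (by fun_prop) (by fun_prop)
    have h2 : MeasurableSet {p : E n × ℝ | p.2 ≤ N p.1} :=
      measurableSet_le (by fun_prop) (by fun_prop)
    exact h1.inter h2
  let ρ : Measure (E n × ℝ) := (lam.prod volume).restrict D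
  have hmass : ρ Set.univ ≤ 2 * C := by
    rw [Measure.restrict_apply_univ, Measure.prod_apply hD]
    calc ∫⁻ ω, volume (Prod.mk ω ⁻¹' D) ∂lam ≤ ∫⁻ ω, 2 * dualNorm B ω ∂lam := by
          refine lintegral_mono fun ω => ?_
          have : Prod.mk ω ⁻¹' D = Set.Icc (-N ω) (N ω) := rfl
          rw [this, Real.volume_Icc, sub_neg_eq_add, ← two_mul, ENNReal.ofReal_mul (by norm_num)]
          simp only [ENNReal.ofReal_ofNat]
          gcongr
          exact ENNReal.ofReal_toReal_le
      _ = 2 * ∫⁻ ω, dualNorm B ω ∂lam := lintegral_const_mul _ (measurable_dualNorm B)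
      _ ≤ 2 * C := by gcongr
  have : IsFiniteMeasure ρ := ⟨hmass.trans_lt (ENNReal.mul_lt_top (by simp) (by simp))⟩
  let r : E n × ℝ → ℝ := fun p => phaseDeriv (G p.1) p.2
  have hrm : Measurable r := by
    have := hGc.measurable
    simp only [r, phaseDeriv]
    fun_prop
  have hrb : ∀ p, |r p| ≤ 1 := fun p => abs_phaseDeriv_le _ _
  have hstep : ∀ x : E n, Measurable fun p : E n × ℝ => unitStep p.2 (inner ℝ p.1 x) := fun x =>
    measurable_unitStep.comp
      (g := fun p : ℝ × ℝ => unitStep p.1 p.2)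
      (f := fun p : E n × ℝ => (p.2, inner ℝ p.1 x)) (by fun_prop)
  have hrint : ∀ x : E n,
      Integrable (fun p : E n × ℝ => r p * (unitStep p.2 (inner ℝ p.1 x) - 1 / 2)) ρ := fun x => by
    refine Integrable.of_bound (C := 1 * (1 / 2))
      (hrm.mul ((hstep x).sub_const _)).aestronglyMeasurable (Eventually.of_forall fun p => ?_)
    rw [Real.norm_eq_abs, abs_mul, abs_unitStep_sub_half]
    gcongr
    exact hrb p
  -- The threshold `0` in `unitStep v u - unitStep v 0` is absorbed into the constant; it is the
  -- value at `x = 0` of the centred mixture.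
  refine ⟨ρ, r, g 0 - ∫ p, r p * (unitStep p.2 (inner ℝ p.1 (0 : E n)) - 1 / 2) ∂ρ, hmass, hrm, hrb,
    fun x hx => ?_⟩
  rw [← hgf hx, sub_add_eq_add_sub, add_sub_assoc, ← integral_sub (hrint x) (hrint 0)]
  obtain ⟨hi, heq⟩ := hinv x hx
  have hre : g x = g 0 +
      ∫ ω : E n, ((Complex.exp (Complex.I * (inner ℝ ω x : ℝ)) - 1) * G ω).re := by
    have h1 := congrArg Complex.re heq
    have h2 := Complex.reCLM.integral_comp_comm hi
    simp only [Complex.reCLM_apply] at h2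
    rw [h2]
    simpa using h1
  rw [hre]
  congr 1
  let F : E n × ℝ → ℝ := fun p => r p * (unitStep p.2 (inner ℝ p.1 x) - unitStep p.2 0)
  have hF : ∀ p : E n × ℝ, r p * (unitStep p.2 (inner ℝ p.1 x) - 1 / 2) -
      r p * (unitStep p.2 (inner ℝ p.1 (0 : E n)) - 1 / 2) = F p := fun p => by
    simp only [F, inner_zero_right]; ring
  have hFi : IntegrableOn F D (lam.prod volume) := by
    have := (hrint x).sub (hrint 0)
    exact this.congr (Eventually.of_forall hF)
  simp_rw [hF]
  change _ = ∫ p in D, F p ∂(lam.prod volume)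
  rw [← integral_indicator hD, integral_prod _ ((integrable_indicator_iff hD).mpr hFi)]
  have hinner : ∀ᵐ ω ∂lam, ∫ v, D.indicator F (ω, v) =
      ∫ v in (0 : ℝ)..(inner ℝ ω x), phaseDeriv (G ω) v := by
    filter_upwards [hfin] with ω hω
    rw [← integral_mul_unitStep_sub (continuous_phaseDeriv (G ω))
      (abs_inner_le_toReal_dualNorm hx hω), ← integral_indicator measurableSet_Icc]
    rfl
  rw [integral_congr_ae hinner, integral_withDensity_eq_integral_smul hGm]
  refine integral_congr_ae (Eventually.of_forall fun ω => ?_)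
  simp only [NNReal.smul_def, coe_nnnorm, smul_eq_mul]
  rw [norm_mul_integral_phaseDeriv]

/-! ### Approximation of a Barron function by one hidden layer -/

lemma measurable_unitStep_inner {n : ℕ} {Z : Type*} [MeasurableSpace Z] {v : Z → ℝ}
    {a y : Z → E n} (hv : Measurable v) (ha : Measurable a) (hy : Measurable y) :
    Measurable fun z => unitStep (v z) (inner ℝ (a z) (y z)) :=
  measurable_unitStep.comp (hv.prodMk (ha.inner hy))

lemma IsBarron.exists_bound {n : ℕ} {B : Set (E n)} {C : ℝ≥0} {f : E n → ℝ}
    (hf : IsBarron B C f) : ∃ R, ∀ x ∈ B, |f x| ≤ R := by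
  obtain ⟨ρ, r, c, hρ, -, hr, hfx⟩ := hf.exists_mixture
  have : IsFiniteMeasure ρ := ⟨hρ.trans_lt (ENNReal.mul_lt_top (by simp) (by simp))⟩
  refine ⟨|c| + 1 * (1 / 2) * ρ.real Set.univ, fun x hx => ?_⟩
  rw [hfx x hx]
  refine (abs_add_le _ _).trans (add_le_add le_rfl ?_)
  rw [← Real.norm_eq_abs]
  refine norm_integral_le_of_norm_le_const (μ := ρ) (C := 1 * (1 / 2))
    (Eventually.of_forall fun p => ?_)
  rw [Real.norm_eq_abs, abs_mul, abs_unitStep_sub_half]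
  gcongr
  exact hr p

/-- Approximation by half-space indicators. The bound is four times better than the one wanted for
sigmoidal functions, which leaves room for replacing the indicators. -/
lemma IsBarron.exists_step_approx {X : Type*} [MeasurableSpace X] {μ : Measure X}
    [IsFiniteMeasure μ] (hμ : μ.real Set.univ ≤ 1) {n : ℕ} {B : Set (E n)} {C : ℝ≥0}
    {f : E n → ℝ} (hf : IsBarron B C f) {Y : X → E n} (hY : Measurable Y)
    (hYB : ∀ᵐ x ∂μ, Y x ∈ B) {k : ℕ} (hk : k = 0 → C = 0) :
    ∃ (c₀ : ℝ) (c : Fin k → ℝ) (a : Fin k → E n) (v : Fin k → ℝ),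
      ∫ x, (f (Y x) - (c₀ + ∑ j, c j * unitStep (v j) (inner ℝ (a j) (Y x)))) ^ 2 ∂μ
        ≤ (C : ℝ) ^ 2 / k := by
  obtain ⟨ρ, r, c, hρ, hrm, hr, hfx⟩ := hf.exists_mixture
  have : IsFiniteMeasure ρ := ⟨hρ.trans_lt (ENNReal.mul_lt_top (by simp) (by simp))⟩
  rcases eq_or_ne ρ 0 with rfl | hρ0
  · refine ⟨c, 0, 0, 0, ?_⟩
    have : ∀ᵐ x ∂μ, (f (Y x) - (c + ∑ j : Fin k, (0 : Fin k → ℝ) j *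
        unitStep ((0 : Fin k → ℝ) j) (inner ℝ ((0 : Fin k → E n) j) (Y x)))) ^ 2 = 0 := by
      filter_upwards [hYB] with x hx
      rw [hfx _ hx]; simp
    rw [integral_congr_ae this, integral_zero]
    positivity
  have : NeZero ρ := ⟨hρ0⟩
  set M : ℝ := ρ.real Set.univ
  have hM0 : 0 < M := by
    simp only [M, measureReal_def]
    exact ENNReal.toReal_pos (by simpa using hρ0) (measure_ne_top _ _)
  have hMC : M ≤ 2 * C := by
    have := ENNReal.toReal_mono (by finiteness) hρ
    simpa [M, measureReal_def] using this
  have hk0 : k ≠ 0 := by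
    intro h
    have := hk h
    simp only [this, NNReal.coe_zero, mul_zero] at hMC
    linarith
  have hk' : (k : ℝ) ≠ 0 := by exact_mod_cast hk0
  let h : E n × ℝ → X → ℝ := fun p x => M * (r p * (unitStep p.2 (inner ℝ p.1 (Y x)) - 1 / 2))
  have hm : Measurable fun p : (E n × ℝ) × X => h p.1 p.2 := by
    have h1 : Measurable fun p : (E n × ℝ) × X => unitStep p.1.2 (inner ℝ p.1.1 (Y p.2)) :=
      measurable_unitStep_inner (by fun_prop) (by fun_prop) (by fun_prop)
    exact (((hrm.comp measurable_fst).mul (h1.sub_const _))).const_mul M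
  have hb : ∀ p x, |h p x| ≤ C := by
    intro p x
    simp only [h, abs_mul, abs_unitStep_sub_half, abs_of_pos hM0]
    calc M * (|r p| * (1 / 2)) ≤ (2 * C) * (1 * (1 / 2)) := by
          gcongr
          exact hr p
      _ = C := by ring
  obtain ⟨θ, hθ⟩ := exists_average_approx μ hμ ((ρ Set.univ)⁻¹ • ρ) hm hb hk0
  refine ⟨c - (k : ℝ)⁻¹ * ∑ j, M * r (θ j) / 2, fun j => (k : ℝ)⁻¹ * (M * r (θ j)),
    fun j => (θ j).1, fun j => (θ j).2, le_of_eq_of_le (integral_congr_ae ?_) hθ⟩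
  filter_upwards [hYB] with x hx
  have hmean : ∫ t, h t x ∂((ρ Set.univ)⁻¹ • ρ) =
      ∫ p, r p * (unitStep p.2 (inner ℝ p.1 (Y x)) - 1 / 2) ∂ρ := by
    rw [integral_smul_measure, integral_const_mul, smul_eq_mul, ENNReal.toReal_inv, ← mul_assoc]
    change M⁻¹ * M * _ = _
    rw [inv_mul_cancel₀ hM0.ne', one_mul]
  rw [hmean, hfx _ hx]
  congr 1
  have hsum : ∑ j, h (θ j) x = ∑ j, M * r (θ j) * unitStep (θ j).2 (inner ℝ (θ j).1 (Y x)) -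
      ∑ j, M * r (θ j) / 2 := by
    rw [← Finset.sum_sub_distrib]
    refine Finset.sum_congr rfl fun j _ => ?_
    simp only [h]; ring
  rw [hsum]
  simp_rw [mul_assoc (k : ℝ)⁻¹]
  rw [← Finset.mul_sum]
  ring

/-- The shift by `N`, of smaller order than the slope `N²`, makes the limit equal to `1` also on
the boundary `u = v`, so that no measure of a hyperplane has to vanish. -/
lemma IsSigmoidal.tendsto_unitStep {σ : ℝ → ℝ} (hσ : IsSigmoidal σ) (v u : ℝ) :
    Tendsto (fun N : ℕ => σ ((N : ℝ) ^ 2 * (u - v) + N)) atTop (𝓝 (unitStep v u)) := by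
  have hN : Tendsto (fun N : ℕ => (N : ℝ)) atTop atTop := tendsto_natCast_atTop_atTop
  unfold unitStep
  split_ifs with h
  · refine hσ.tendsto_atTop.comp (tendsto_atTop_mono (fun N => ?_) hN)
    have : 0 ≤ (N : ℝ) ^ 2 * (u - v) := mul_nonneg (by positivity) (by linarith)
    linarith
  · refine hσ.tendsto_atBot.comp ?_
    have h1 : Tendsto (fun N : ℕ => (N : ℝ) * (u - v) + 1) atTop atBot :=
      tendsto_atBot_add_const_right _ _ (hN.atTop_mul_const_of_neg (by linarith))
    refine (hN.atTop_mul_atBot₀ h1).congr fun N => ?_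
    ring

/-- Approximation of a real Barron function by a linear combination of sigmoids. -/
theorem IsBarron.exists_sigmoid_approx {σ : ℝ → ℝ} (hσ : IsSigmoidal σ) {X : Type*}
    [MeasurableSpace X] {μ : Measure X} [IsFiniteMeasure μ] (hμ : μ.real Set.univ ≤ 1) {n : ℕ}
    {B : Set (E n)} {C : ℝ≥0} {f : E n → ℝ} (hf : IsBarron B C f) (hfm : Measurable f)
    {Y : X → E n} (hY : Measurable Y) (hYB : ∀ᵐ x ∂μ, Y x ∈ B) {k : ℕ} {δ : ℝ} (hδ : 0 < δ)
    (hk : 4 * (C : ℝ) ^ 2 ≤ k * δ) :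
    ∃ (c₀ : ℝ) (c : Fin k → ℝ) (a : Fin k → E n) (b : Fin k → ℝ),
      Integrable (fun x => (f (Y x) - (c₀ + ∑ j, c j * σ (inner ℝ (a j) (Y x) + b j))) ^ 2) μ ∧
      ∫ x, (f (Y x) - (c₀ + ∑ j, c j * σ (inner ℝ (a j) (Y x) + b j))) ^ 2 ∂μ ≤ δ := by
  obtain ⟨R, hR⟩ := hf.exists_bound
  obtain ⟨T, hT⟩ := hσ.bounded
  have hσm := hσ.measurable
  have hk0 : k = 0 → C = 0 := by
    rintro rfl
    have : (C : ℝ) ^ 2 ≤ 0 := by simp only [Nat.cast_zero, zero_mul] at hk; linarith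
    exact_mod_cast pow_eq_zero_iff (two_ne_zero) |>.mp (le_antisymm this (sq_nonneg _))
  obtain ⟨c₀, c, a, v, happ⟩ := hf.exists_step_approx hμ hY hYB hk0
  have hlt : (C : ℝ) ^ 2 / k < δ := by
    rcases eq_or_ne k 0 with rfl | h
    · simpa using hδ
    · have hkpos : (0 : ℝ) < k := by exact_mod_cast Nat.pos_of_ne_zero h
      rw [div_lt_iff₀ hkpos]
      nlinarith [mul_pos hδ hkpos]
  let F : ℕ → X → ℝ := fun N x => (f (Y x) -
    (c₀ + ∑ j, c j * σ ((N : ℝ) ^ 2 * (inner ℝ (a j) (Y x) - v j) + N))) ^ 2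
  have hFm : ∀ N, AEStronglyMeasurable (F N) μ := fun N => by
    refine Measurable.aestronglyMeasurable ?_
    simp only [F]
    fun_prop
  let bd : ℝ := (R + (|c₀| + ∑ j, |c j| * T)) ^ 2
  have hFb : ∀ N, ∀ᵐ x ∂μ, ‖F N x‖ ≤ bd := fun N => by
    filter_upwards [hYB] with x hx
    simp only [F, bd, norm_pow, Real.norm_eq_abs]
    gcongr
    refine (abs_sub _ _).trans (add_le_add (hR _ hx) ((abs_add_le _ _).trans ?_))
    gcongr
    refine (Finset.abs_sum_le_sum_abs _ _).trans (Finset.sum_le_sum fun j _ => ?_)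
    rw [abs_mul]
    gcongr
    exact hT _
  have hlim : Tendsto (fun N => ∫ x, F N x ∂μ) atTop
      (𝓝 (∫ x, (f (Y x) - (c₀ + ∑ j, c j * unitStep (v j) (inner ℝ (a j) (Y x)))) ^ 2 ∂μ)) := by
    refine tendsto_integral_of_dominated_convergence (fun _ => bd) hFm (integrable_const _) hFb ?_
    refine Eventually.of_forall fun x => ?_
    refine ((tendsto_const_nhds.sub (tendsto_const_nhds.add
      (tendsto_finsetSum _ fun j _ => ?_))).pow 2)
    exact (hσ.tendsto_unitStep _ _).const_mul _
  obtain ⟨N, hN⟩ := (hlim.eventually (gt_mem_nhds (happ.trans_lt hlt))).exists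
  have heq : ∀ x, F N x = (f (Y x) - (c₀ + ∑ j, c j *
      σ (inner ℝ ((N : ℝ) ^ 2 • a j) (Y x) + (N - (N : ℝ) ^ 2 * v j)))) ^ 2 := by
    intro x
    have hj : ∀ j, (N : ℝ) ^ 2 * (inner ℝ (a j) (Y x) - v j) + N =
        inner ℝ ((N : ℝ) ^ 2 • a j) (Y x) + (N - (N : ℝ) ^ 2 * v j) := fun j => by
      rw [real_inner_smul_left]; ring
    simp only [F, hj]
  refine ⟨c₀, c, fun j => (N : ℝ) ^ 2 • a j, fun j => N - (N : ℝ) ^ 2 * v j, ?_, ?_⟩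
  · exact (Integrable.of_bound (hFm N) bd (hFb N)).congr (Eventually.of_forall heq)
  · simp_rw [← heq]
    exact hN.le

lemma eLpNorm_two_le_of_integral_le {X F : Type*} [MeasurableSpace X] {μ : Measure X}
    [NormedAddCommGroup F] {φ : X → F} {ε : ℝ} (hε : 0 ≤ ε)
    (hi : Integrable (fun x => ‖φ x‖ ^ 2) μ) (h : ∫ x, ‖φ x‖ ^ 2 ∂μ ≤ ε ^ 2) :
    eLpNorm φ 2 μ ≤ ENNReal.ofReal ε := by
  have h1 : ∫⁻ x, ‖φ x‖ₑ ^ (2 : ℝ) ∂μ = ENNReal.ofReal (∫ x, ‖φ x‖ ^ 2 ∂μ) := by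
    rw [ofReal_integral_eq_lintegral_ofReal hi (Eventually.of_forall fun x => by positivity)]
    refine lintegral_congr fun x => ?_
    rw [ENNReal.ofReal_pow (norm_nonneg _), ofReal_norm]
    norm_num
  rw [eLpNorm_eq_lintegral_rpow_enorm_toReal two_ne_zero ENNReal.ofNat_ne_top,
    ENNReal.toReal_ofNat, h1, ENNReal.ofReal_rpow_of_nonneg (by positivity) (by norm_num)]
  refine ENNReal.ofReal_le_ofReal ?_
  rw [← Real.sqrt_eq_rpow]
  exact Real.sqrt_le_iff.mpr ⟨hε, h⟩

/-- Approximation of a vector-valued Barron function by a network with one hidden layer, which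
consists of `k` nodes for each component. -/
theorem IsBarronVec.exists_layer {σ : ℝ → ℝ} (hσ : IsSigmoidal σ) {X : Type*}
    [MeasurableSpace X] {μ : Measure X} [IsFiniteMeasure μ] (hμ : μ.real Set.univ ≤ 1) {n p : ℕ}
    {B : Set (E n)} {C : ℝ≥0} {f : E n → E p} (hf : IsBarronVec B C f) (hfm : Measurable f)
    {Y : X → E n} (hY : Measurable Y) (hYB : ∀ᵐ x ∂μ, Y x ∈ B) {k : ℕ} {ε : ℝ} (hε : 0 < ε)
    (hk : 4 * (C : ℝ) ^ 2 * p / ε ^ 2 ≤ k) :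
    ∃ N : NeuralNet n [p * k] p,
      eLpNorm (fun x => f (Y x) - N.eval σ (Y x)) 2 μ ≤ ENNReal.ofReal ε := by
  have hcomp : ∀ j : Fin p, ∃ (c₀ : ℝ) (c : Fin k → ℝ) (a : Fin k → E n) (b : Fin k → ℝ),
      Integrable (fun x => (f (Y x) j - (c₀ + ∑ i, c i * σ (inner ℝ (a i) (Y x) + b i))) ^ 2) μ ∧
      ∫ x, (f (Y x) j - (c₀ + ∑ i, c i * σ (inner ℝ (a i) (Y x) + b i))) ^ 2 ∂μ
        ≤ ε ^ 2 / p := by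
    intro j
    have hp : (0 : ℝ) < p := by exact_mod_cast j.pos
    refine (hf j).exists_sigmoid_approx hσ hμ (by fun_prop) hY hYB (by positivity) ?_
    rw [div_le_iff₀ (by positivity)] at hk
    rw [← mul_div_assoc, le_div_iff₀ hp]
    exact hk
  choose c₀ c a b hint hle using hcomp
  let e : Fin (p * k) ≃ Fin p × Fin k := finProdFinEquiv.symm
  let N : NeuralNet n [p * k] p := .hidden
    (Matrix.of fun q i => a (e q).1 (e q).2 i) (fun q => b (e q).1 (e q).2)
    (.output (Matrix.of fun j q => if j = (e q).1 then c j (e q).2 else 0) c₀)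
  have hN : ∀ (y : E n) (j : Fin p),
      N.eval σ y j = c₀ j + ∑ i, c j i * σ (inner ℝ (a j i) y + b j i) := by
    intro y j
    have hinner : ∀ w : E n, ∑ i, w i * y i = inner ℝ w y := fun w => by
      rw [PiLp.inner_apply]
      refine Finset.sum_congr rfl fun i _ => ?_
      simp [mul_comm]
    simp only [N, NeuralNet.eval, Matrix.mulVec, dotProduct, Matrix.of_apply, hinner]
    rw [add_comm, e.sum_comp fun t => (if j = t.1 then c j t.2 else 0) *
      σ (inner ℝ (a t.1 t.2) y + b t.1 t.2), Fintype.sum_prod_type]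
    simp [Finset.sum_ite_irrel]
  have hnorm : ∀ x, ‖f (Y x) - N.eval σ (Y x)‖ ^ 2 = ∑ j, (f (Y x) j -
      (c₀ j + ∑ i, c j i * σ (inner ℝ (a j i) (Y x) + b j i))) ^ 2 := by
    intro x
    rw [EuclideanSpace.real_norm_sq_eq]
    refine Finset.sum_congr rfl fun j _ => ?_
    rw [← hN]; rfl
  refine ⟨N, eLpNorm_two_le_of_integral_le hε.le ?_ ?_⟩
  · simp_rw [hnorm]
    exact integrable_finsetSum _ fun j _ => hint j
  · simp_rw [hnorm]
    rw [integral_finsetSum _ fun j _ => hint j]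
    refine (Finset.sum_le_sum fun j _ => hle j).trans ?_
    rcases eq_or_ne p 0 with rfl | hp
    · simp; positivity
    · have : (p : ℝ) ≠ 0 := by exact_mod_cast hp
      simp only [Finset.sum_const, Finset.card_univ, Fintype.card_fin, nsmul_eq_mul]
      rw [mul_div_cancel₀ _ this]

/-! ### Networks and their composition -/

lemma NeuralNet.measurable_eval {σ : ℝ → ℝ} (hσ : Measurable σ) {p : ℕ} {hs : List ℕ} {q : ℕ}
    (N : NeuralNet p hs q) : Measurable (N.eval σ) := by
  have haff : ∀ {p q : ℕ} (A : Matrix (Fin q) (Fin p) ℝ) (b : Fin q → ℝ) (j : Fin q),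
      Measurable fun x : E p => (A.mulVec x.ofLp) j + b j := by
    intro p q A b j
    simp only [Matrix.mulVec, dotProduct]
    fun_prop
  induction N with
  | output A b =>
    exact (WithLp.measurable_toLp 2 _).comp (measurable_pi_lambda _ fun j => haff A b j)
  | hidden A b N ih =>
    exact ih.comp ((WithLp.measurable_toLp 2 _).comp
      (measurable_pi_lambda _ fun j => hσ.comp (haff A b j)))

/-- The composition of two networks is a network, whose hidden layers are those of the first
followed by those of the second: the output layer of the first merges with the first affine map of
the second. -/
lemma NeuralNet.exists_comp (σ : ℝ → ℝ) {p : ℕ} {hs : List ℕ} {q : ℕ} (N : NeuralNet p hs q)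
    {hs' : List ℕ} {r : ℕ} (N' : NeuralNet q hs' r) :
    ∃ N'' : NeuralNet p (hs ++ hs') r, ∀ x, N''.eval σ x = N'.eval σ (N.eval σ x) := by
  induction N with
  | hidden A b N ih =>
    obtain ⟨N'', h⟩ := ih N'
    exact ⟨.hidden A b N'', fun x => h _⟩
  | output A b =>
    have haff : ∀ {s : ℕ} (A' : Matrix (Fin s) _ ℝ) (b' : Fin s → ℝ) (x : E _) (j : Fin s),
        ((A' * A).mulVec x.ofLp) j + (A'.mulVec b + b') j =
          (A'.mulVec fun i => (A.mulVec x.ofLp) i + b i) j + b' j := by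
      intro s A' b' x j
      change _ = (A'.mulVec (A.mulVec x.ofLp + b)) j + b' j
      rw [Matrix.mulVec_add, Matrix.mulVec_mulVec, Pi.add_apply, Pi.add_apply, add_assoc]
    cases N' with
    | output A' b' =>
      refine ⟨.output (A' * A) (A'.mulVec b + b'), fun x => ?_⟩
      simp only [NeuralNet.eval, haff]
    | hidden A' b' N' =>
      refine ⟨.hidden (A' * A) (A'.mulVec b + b') N', fun x => ?_⟩
      simp only [NeuralNet.eval, haff]

/-! ### Propagation of the error through the chain -/

lemma continuous_chain {m : ℕ → ℕ} {f : ∀ i, E (m i) → E (m (i + 1))} {l : ℕ}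
    (hf : ∀ i < l, Continuous (f i)) : Continuous (chain f l) := by
  induction l with
  | zero => exact continuous_id
  | succ l ih => exact (hf l l.lt_succ_self).comp (ih fun i hi => hf i (hi.trans l.lt_succ_self))

lemma mapsTo_chain {m : ℕ → ℕ} {f : ∀ i, E (m i) → E (m (i + 1))} {K : ∀ i, Set (E (m i))} {l : ℕ}
    (hf : ∀ i < l, Set.MapsTo (f i) (K i) (K (i + 1))) :
    Set.MapsTo (chain f l) (K 0) (K l) := by
  induction l with
  | zero => exact fun x hx => hx
  | succ l ih =>
    exact (hf l l.lt_succ_self).comp (ih fun i hi => hf i (hi.trans l.lt_succ_self))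

/-- Chebyshev's inequality, for the part of `S` on which `φ` is not larger than `s`. -/
lemma measureReal_sub_le_of_eLpNorm_le {X F : Type*} [MeasurableSpace X] {μ : Measure X}
    [IsFiniteMeasure μ] [NormedAddCommGroup F] {φ : X → F} {S : Set X} (hS : MeasurableSet S)
    (hφ : AEStronglyMeasurable φ (μ.restrict S)) {a s : ℝ} (ha : 0 ≤ a) (hs : 0 < s)
    (h : eLpNorm φ 2 (μ.restrict S) ≤ ENNReal.ofReal a) :
    μ.real S - a ^ 2 / s ^ 2 ≤ μ.real (S ∩ {x | ‖φ x‖ ≤ s}) := by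
  have hs' : ENNReal.ofReal s ≠ 0 := by simpa using hs
  have h1 : (μ.restrict S) {x | ENNReal.ofReal s ≤ ‖φ x‖ₑ} ≤ ENNReal.ofReal (a ^ 2 / s ^ 2) := by
    refine (meas_ge_le_mul_pow_eLpNorm_enorm _ two_ne_zero ENNReal.ofNat_ne_top hφ hs'
      (by simp)).trans ?_
    calc (ENNReal.ofReal s)⁻¹ ^ (2 : ℝ≥0∞).toReal *
          eLpNorm φ 2 (μ.restrict S) ^ (2 : ℝ≥0∞).toReal
        ≤ (ENNReal.ofReal s)⁻¹ ^ (2 : ℝ≥0∞).toReal * ENNReal.ofReal a ^ (2 : ℝ≥0∞).toReal := by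
          gcongr
      _ = ENNReal.ofReal (a ^ 2 / s ^ 2) := by
          rw [← ENNReal.ofReal_inv_of_pos hs]
          simp only [ENNReal.toReal_ofNat, ENNReal.rpow_ofNat]
          rw [← ENNReal.ofReal_pow (by positivity), ← ENNReal.ofReal_pow ha,
            ← ENNReal.ofReal_mul (by positivity)]
          congr 1; field_simp
  have h2 : μ.real (S ∩ {x | ‖φ x‖ ≤ s}ᶜ) ≤ a ^ 2 / s ^ 2 := by
    rw [measureReal_def]
    refine ENNReal.toReal_le_of_le_ofReal (by positivity) (le_trans ?_ h1)
    rw [Measure.restrict_apply' hS, Set.inter_comm]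
    refine measure_mono (Set.inter_subset_inter_left _ fun x hx => ?_)
    simp only [Set.mem_compl_iff, Set.mem_ofPred_eq, not_le] at hx ⊢
    rw [← ofReal_norm]
    exact ENNReal.ofReal_le_ofReal hx.le
  have h3 : μ.real S ≤ μ.real (S ∩ {x | ‖φ x‖ ≤ s}) + μ.real (S ∩ {x | ‖φ x‖ ≤ s}ᶜ) := by
    conv_lhs => rw [← Set.inter_union_compl S {x | ‖φ x‖ ≤ s}]
    exact measureReal_union_le _ _
  linarith

/-- The induction over the layers. The error after `l` layers is controlled on a set `S` on which
the intermediate outputs of the network have stayed in the neighbourhoods `K i + s B`; before the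
next layer is added, `S` is cut down to the points at which the current error is at most `s`. -/
lemma exists_net_chain {ε s : ℝ} (hε : 0 < ε) (hs : 0 < s) {σ : ℝ → ℝ} (hσ : IsSigmoidal σ)
    {m : ℕ → ℕ} {f : ∀ i, E (m i) → E (m (i + 1))} {μ₀ : Measure (E (m 0))}
    [IsProbabilityMeasure μ₀] {K : ∀ i, Set (E (m i))} {C : ℕ → ℝ≥0}
    (hK : ∀ᵐ x ∂μ₀, x ∈ K 0) (l : ℕ) (hlip : ∀ i < l, LipschitzWith 1 (f i))
    (hbarron : ∀ i < l, IsBarronVec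
      (K i + s • Metric.closedBall (0 : E (m i)) 1) (C (i + 1)) (f i))
    (hmaps : ∀ i < l, Set.MapsTo (f i) (K i) (K (i + 1))) :
    ∃ (g : NeuralNet (m 0)
          ((List.range l).map fun i =>
            m (i + 1) * ⌈4 * (C (i + 1) : ℝ) ^ 2 * (m (i + 1) : ℝ) / ε ^ 2⌉₊)
          (m l))
      (S : Set (E (m 0))),
      MeasurableSet S ∧
      1 - (∑ i ∈ Finset.range l, (i : ℝ) ^ 2) * ε ^ 2 / s ^ 2 ≤ μ₀.real S ∧
      eLpNorm (fun x => chain f l x - g.eval σ x) 2 (μ₀.restrict S) ≤ ENNReal.ofReal (l * ε) := by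
  induction l with
  | zero =>
    refine ⟨.output 1 0, Set.univ, MeasurableSet.univ, by simp, ?_⟩
    have : (fun x => chain f 0 x - (NeuralNet.output (1 : Matrix (Fin (m 0)) _ ℝ) 0).eval σ x) =
        0 := by
      funext x
      simp only [chain, NeuralNet.eval, Matrix.one_mulVec, Pi.zero_apply, add_zero]
      exact sub_self x
    have hz : eLpNorm (fun x => chain f 0 x -
        (NeuralNet.output (1 : Matrix (Fin (m 0)) _ ℝ) 0).eval σ x) 2
        (μ₀.restrict Set.univ) = 0 := by
      rw [this]; exact eLpNorm_zero
    exact hz.trans_le zero_le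
  | succ l ih =>
    obtain ⟨g, S, hS, hμS, herr⟩ := ih (fun i hi => hlip i (hi.trans l.lt_succ_self))
      (fun i hi => hbarron i (hi.trans l.lt_succ_self))
      (fun i hi => hmaps i (hi.trans l.lt_succ_self))
    have hgm : Measurable (g.eval σ) := g.measurable_eval hσ.measurable
    have hcm : Measurable (chain f l) :=
      (continuous_chain fun i hi => (hlip i (hi.trans l.lt_succ_self)).continuous).measurable
    have hfl := hlip l l.lt_succ_self
    have hfm : Measurable (f l) := hfl.continuous.measurable
    have hφm : Measurable fun x => chain f l x - g.eval σ x := hcm.sub hgm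
    set T : Set (E (m 0)) := S ∩ {x | ‖chain f l x - g.eval σ x‖ ≤ s}
    have hT : MeasurableSet T := hS.inter (measurableSet_le hφm.norm measurable_const)
    have hμT : μ₀.real S - (l * ε) ^ 2 / s ^ 2 ≤ μ₀.real T :=
      measureReal_sub_le_of_eLpNorm_le hS hφm.aestronglyMeasurable (by positivity) hs herr
    have hYB : ∀ᵐ x ∂μ₀.restrict T,
        g.eval σ x ∈ K l + s • Metric.closedBall (0 : E (m l)) 1 := by
      filter_upwards [ae_restrict_mem hT, ae_restrict_of_ae hK] with x hxT hxK
      refine ⟨chain f l x,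
        mapsTo_chain (fun i hi => hmaps i (hi.trans l.lt_succ_self)) hxK,
        g.eval σ x - chain f l x, ?_, add_sub_cancel _ _⟩
      rw [smul_unitClosedBall_of_nonneg hs.le, mem_closedBall_zero_iff, norm_sub_rev]
      exact hxT.2
    have hmass : (μ₀.restrict T).real Set.univ ≤ 1 := by
      rw [measureReal_restrict_apply_univ]
      exact measureReal_le_one
    obtain ⟨N, hN⟩ := (hbarron l l.lt_succ_self).exists_layer hσ hmass hfm hgm hYB hε
      (Nat.le_ceil _)
    have hcomp : ∃ g' : NeuralNet (m 0)
          ((List.range (l + 1)).map fun i =>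
            m (i + 1) * ⌈4 * (C (i + 1) : ℝ) ^ 2 * (m (i + 1) : ℝ) / ε ^ 2⌉₊)
          (m (l + 1)), ∀ x, g'.eval σ x = N.eval σ (g.eval σ x) := by
      rw [List.range_succ, List.map_append]
      exact g.exists_comp σ N
    obtain ⟨g', hg'⟩ := hcomp
    refine ⟨g', T, hT, ?_, ?_⟩
    · rw [Finset.sum_range_succ]
      calc _ = 1 - (∑ i ∈ Finset.range l, (i : ℝ) ^ 2) * ε ^ 2 / s ^ 2 - (l * ε) ^ 2 / s ^ 2 := by
            ring
        _ ≤ _ := by linarith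
    · have hsplit : (fun x => chain f (l + 1) x - g'.eval σ x) =
          (fun x => f l (chain f l x) - f l (g.eval σ x)) +
            fun x => f l (g.eval σ x) - N.eval σ (g.eval σ x) := by
        funext x
        simp [hg', chain]
      have hm1 : Measurable fun x => f l (chain f l x) - f l (g.eval σ x) :=
        (hfm.comp hcm).sub (hfm.comp hgm)
      have hm2 : Measurable fun x => f l (g.eval σ x) - N.eval σ (g.eval σ x) :=
        (hfm.comp hgm).sub ((N.measurable_eval hσ.measurable).comp hgm)
      have h1 : eLpNorm (fun x => f l (chain f l x) - f l (g.eval σ x)) 2 (μ₀.restrict T) ≤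
          ENNReal.ofReal (l * ε) := by
        refine le_trans (eLpNorm_mono fun x => ?_)
          ((eLpNorm_mono_measure _ (Measure.restrict_mono Set.inter_subset_left le_rfl)).trans
            herr)
        simpa using hfl.norm_sub_le (chain f l x) (g.eval σ x)
      rw [hsplit]
      refine (eLpNorm_add_le hm1.aestronglyMeasurable hm2.aestronglyMeasurable
        one_le_two).trans ((add_le_add h1 hN).trans_eq ?_)
      rw [← ENNReal.ofReal_add (by positivity) hε.le]
      push_cast
      ring_nf

lemma sqrt_integral_sq_norm_eq {X F : Type*} [MeasurableSpace X] {μ : Measure X}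
    [NormedAddCommGroup F] {φ : X → F} (h : MemLp φ 2 μ) :
    √(∫ x, ‖φ x‖ ^ 2 ∂μ) = (eLpNorm φ 2 μ).toReal := by
  rw [h.eLpNorm_eq_integral_rpow_norm two_ne_zero ENNReal.ofNat_ne_top,
    ENNReal.toReal_ofReal (by positivity), Real.sqrt_eq_rpow]
  simp

end MultiBarron

end

/-- The function `f i`, for `i < l`, is the `(i+1)`-st function `f_{i+1} : ℝ^{m_i} → ℝ^{m_{i+1}}`
of the chain; the data with larger indices play no role. -/
theorem theorem3p2
    (ε s : ℝ) (hε : 0 < ε) (hs : 0 < s) (l : ℕ) (hl : 1 ≤ l)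
    (σ : ℝ → ℝ) (hσ : MultiBarron.IsSigmoidal σ)
    (m : ℕ → ℕ)
    (f : ∀ i, MultiBarron.E (m i) → MultiBarron.E (m (i + 1)))
    (μ₀ : Measure (MultiBarron.E (m 0))) [IsProbabilityMeasure μ₀]
    (K : ∀ i, Set (MultiBarron.E (m i)))
    (C : ℕ → ℝ≥0)
    (hsupp : μ₀.support ⊆ K 0)
    (hlip : ∀ i < l, LipschitzWith 1 (f i))
    (hbarron₀ : MultiBarron.IsBarronVec (K 0) (C 0) (f 0))
    (hbarron : ∀ i < l, MultiBarron.IsBarronVec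
      (K i + s • Metric.closedBall (0 : MultiBarron.E (m i)) 1) (C (i + 1)) (f i))
    (hmaps : ∀ i < l, Set.MapsTo (f i) (K i) (K (i + 1))) :
    ∃ (g : MultiBarron.NeuralNet (m 0)
          ((List.range l).map fun i =>
            m (i + 1) * ⌈4 * (C (i + 1) : ℝ) ^ 2 * (m (i + 1) : ℝ) / ε ^ 2⌉₊)
          (m l))
      (S : Set (MultiBarron.E (m 0))),
      MeasurableSet S ∧
      1 - (∑ i ∈ Finset.Ico 1 l, (i : ℝ) ^ 2) * ε ^ 2 / s ^ 2 ≤ μ₀.real S ∧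
      IntegrableOn (fun x => ‖MultiBarron.chain f l x - g.eval σ x‖ ^ 2) S μ₀ ∧
      √(∫ x in S, ‖MultiBarron.chain f l x - g.eval σ x‖ ^ 2 ∂μ₀) ≤ l * ε := by
  obtain ⟨g, S, hS, hμS, herr⟩ := MultiBarron.exists_net_chain hε hs hσ
    (Filter.mem_of_superset Measure.support_mem_ae hsupp) l hlip hbarron hmaps
  have hφm : Measurable fun x => MultiBarron.chain f l x - g.eval σ x :=
    (MultiBarron.continuous_chain fun i hi => (hlip i hi).continuous).measurable.sub
      (g.measurable_eval hσ.measurable)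
  have hLp : MemLp (fun x => MultiBarron.chain f l x - g.eval σ x) 2 (μ₀.restrict S) :=
    ⟨hφm.aestronglyMeasurable, herr.trans_lt ENNReal.ofReal_lt_top⟩
  -- The index `0` contributes nothing to the sum of the squares.
  have hsum : ∑ i ∈ Finset.range l, (i : ℝ) ^ 2 = ∑ i ∈ Finset.Ico 1 l, (i : ℝ) ^ 2 := by
    rw [Finset.range_eq_Ico, Finset.sum_eq_sum_Ico_succ_bot hl]
    simp
  rw [hsum] at hμS
  refine ⟨g, S, hS, hμS, (memLp_two_iff_integrable_sq_norm hLp.1).mp hLp, ?_⟩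
  rw [MultiBarron.sqrt_integral_sq_norm_eq hLp]
  exact ENNReal.toReal_le_of_le_ofReal (by positivity) herr
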